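/- Let $(L/K,v)$ be an extension of valued fields with $L=K(\eta)$, $\eta$ algebraic over $K$ with minimal polynomial $g$, let $\mathcal O_L$ and $\mathcal O_K$ be the valuation rings of $v$ and $v|_K$, and let $\nu$ be the valuation on $K[x]$ with support $(g)$ given by $\nu(f)=v(f(\eta))$. Fix an extension $\overline\nu$ of $\nu$ to $\overline K[x]$, where $\overline K$ is an algebraic closure of $K$; all valuations take values in $\Gamma\cup\{\infty\}$ for a common ordered abelian group $\Gamma$. For $f\in K[x]\setminus K$ put $\epsilon(f)=\max\{\overline\nu(x-a)\mid a \text{ a root of } f \text{ in }\overline K\}$. A monic $Q\in K[x]\setminus K$ is a *key polynomial* for $\nu$ if $\epsilon(f)<\epsilon(Q)$ for every $f\in K[x]\setminus K$ with $\deg f<\deg Q$. For a monic $q\in K[x]\setminus K$ and the $q$-expansion $f=\sum_i f_iq^i$ ($\deg f_i<\deg q$) put $\nu_q(f)=\min_i\nu(f_iq^i)$. A *sequence of key polynomials* for $\nu$ is a family $\mathbf Q=\{Q_i\}_{i\in I}$ of key polynomials indexed by a well-ordered set $I$, with $i\mapsto\epsilon(Q_i)$ non-decreasing, which is complete: for every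 $f\in K[x]\setminus K$ there is $q\in\mathbf Q$ with $\deg q\le\deg f$ and $\nu(f)=\nu_q(f)$. Let $\mathbf Q_1$ be the set of its elements of degree $1$; it is a *plateau* if it is non-empty and $\{\nu(Q)\mid Q\in\mathbf Q_1\}$ has no maximum. A *limit key polynomial* for $\mathbf Q_1$ is a monic polynomial of smallest degree among the $F\in K[x]$ with $\nu_Q(F)\ne\nu(F)$ for all $Q\in\mathbf Q_1$. For such an $F$, with $Q$-expansions $F=a_{Q0}+a_{Q1}Q+\dots+a_{QD}Q^D$, let $\delta^L$ be the smallest initial segment of $\Gamma$ containing $\{\nu_Q(F)\mid Q\in\mathbf Q_1\}$ and let $$B(F)=\{b\in\{1,\dots,D-1\}\mid \nu(a_{Qb}Q^b)\in\delta^L\text{ for every }Q\in\mathbf Q_1\text{ with large enough value }\nu(Q)\}.$$ **Proposition.** Assume that $\{\nu(x-a)\mid a\in K\}$ does not have a maximum and that $\nu$ admits no key polynomial of degree $n$ for any $n$ with $1<n<\deg g$. Let $\mathbf Q$ be any sequence of key polynomials for $\nu$. Then $\mathbf Q_1$ is a plateau, limit key polynomials for $\mathbf Q_1$ exist, and for every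 limit key polynomial $F$ for $\mathbf Q_1$, $$\Omega_{\mathcal O_L/\mathcal O_K}=\{0\}\iff 1\in B(F).$$ That is, $\Omega_{\mathcal O_L/\mathcal O_K}=\{0\}$ if and only if $1\in B_1$, where $B_1=B(F)$ for any limit key polynomial $F$ for $\mathbf Q_1$. -/

import Mathlib

open Polynomial

namespace KeyPol

noncomputable section

/-- The valuation ring `{y | 0 ≤ v y}` of an (additively written) valuation on a field. -/
def valRing {F Γ : Type*} [Field F] [AddCommGroup Γ] [LinearOrder Γ] [IsOrderedAddMonoid Γ]
    (v : AddValuation F (WithTop Γ)) : Subring F where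
  carrier := {y | 0 ≤ v y}
  mul_mem' {a b} ha hb := by
    simp only [Set.mem_ofPred_eq, AddValuation.map_mul] at *
    exact add_nonneg ha hb
  one_mem' := by simp
  add_mem' {a b} ha hb := le_trans (le_min ha hb) (v.map_add a b)
  zero_mem' := by simp
  neg_mem' {a} ha := by simpa using ha

/-- The restriction to `K` of a valuation `v` on an extension field `L` of `K`. -/
abbrev restrict (K : Type*) {L Γ : Type*} [Field K] [Field L] [Algebra K L]
    [AddCommGroup Γ] [LinearOrder Γ] [IsOrderedAddMonoid Γ]
    (v : AddValuation L (WithTop Γ)) : AddValuation K (WithTop Γ) :=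
  v.comap (algebraMap K L)

/-- The valuation ring of `L` is an algebra over the valuation ring of `K`, by inclusion. -/
instance instAlgebraValRing {K L Γ : Type*} [Field K] [Field L] [Algebra K L]
    [AddCommGroup Γ] [LinearOrder Γ] [IsOrderedAddMonoid Γ]
    (v : AddValuation L (WithTop Γ)) : Algebra (valRing (restrict K v)) (valRing v) :=
  ((algebraMap K L).restrict (valRing (restrict K v)) (valRing v) (fun _ h => h)).toAlgebra

section Expansions

variable {K Γ : Type*} [Field K] [AddCommGroup Γ] [LinearOrder Γ] [IsOrderedAddMonoid Γ]

/-- The `i`-th coefficient `f_i` of the `q`-expansion `f = f_0 + f_1 q + ... + f_n q ^ n`,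
`deg f_i < deg q`, where `q` is monic of positive degree: divide `i` times by `q`,
then take the remainder. -/
def expCoeff (q f : K[X]) (i : ℕ) : K[X] :=
  ((fun h : K[X] => h /ₘ q)^[i] f) %ₘ q

theorem expCoeff_degree_lt {q : K[X]} (hq : q.Monic) (f : K[X]) (i : ℕ) :
    (expCoeff q f i).degree < q.degree :=
  degree_modByMonic_lt _ hq

theorem sum_expCoeff {q : K[X]} (hq : q.Monic) (hd : 1 ≤ q.natDegree) (f : K[X]) :
    f = ∑ i ∈ Finset.range (f.natDegree + 1), expCoeff q f i * q ^ i := by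
  suffices H : ∀ n : ℕ, ∀ f : K[X], f.natDegree < n →
      f = ∑ i ∈ Finset.range n, expCoeff q f i * q ^ i from H _ f (Nat.lt_succ_self _)
  intro n
  induction n with
  | zero => intro f hf; omega
  | succ n ih =>
    intro f hf
    have key : f /ₘ q = ∑ i ∈ Finset.range n, expCoeff q (f /ₘ q) i * q ^ i := by
      rcases Nat.eq_zero_or_pos n with hn | hn
      · subst hn
        have : f.natDegree < q.natDegree := by omega
        rw [(divByMonic_eq_zero_iff hq).2 (degree_lt_degree this)]
        simp
      · apply ih
        rw [natDegree_divByMonic f hq]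
        omega
    rw [Finset.sum_range_succ']
    have h1 : ∀ i, expCoeff q f (i + 1) = expCoeff q (f /ₘ q) i := fun i => by
      simp [expCoeff, Function.iterate_succ_apply]
    have h2 : ∑ i ∈ Finset.range n, expCoeff q f (i + 1) * q ^ (i + 1) = q * (f /ₘ q) := by
      conv_rhs => rw [key, Finset.mul_sum]
      refine Finset.sum_congr rfl fun i _ => ?_
      rw [h1, pow_succ]; ring
    rw [h2]
    simp only [expCoeff, Function.iterate_zero, id, pow_zero, mul_one]
    rw [add_comm]
    exact (modByMonic_add_div f q).symm

/-- The truncation `ν_q (f) = min_i ν (f_i q ^ i)` of `ν` at a monic `q` of positive degree,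
`f = ∑ f_i q ^ i` being the `q`-expansion. -/
def truncation (ν : AddValuation K[X] (WithTop Γ)) (q f : K[X]) : WithTop Γ :=
  (Finset.range (f.natDegree + 1)).inf fun i => ν (expCoeff q f i * q ^ i)

/-- `S` is a complete set for `ν`: its elements are nonconstant, and every nonconstant `f`
satisfies `ν f = ν_q f` for some `q ∈ S` with `deg q ≤ deg f`. -/
def IsComplete (ν : AddValuation K[X] (WithTop Γ)) (S : Set K[X]) : Prop :=
  (∀ q ∈ S, 1 ≤ q.natDegree) ∧
    ∀ f : K[X], 1 ≤ f.natDegree →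
      ∃ q ∈ S, q.natDegree ≤ f.natDegree ∧ ν f = truncation ν q f

/-- The subset `S_n` of elements of degree `n`. -/
def ofDegree (S : Set K[X]) (n : ℕ) : Set K[X] := {q ∈ S | q.natDegree = n}

/-- A plateau: a nonempty set of polynomials without a last element with respect to `ν`. -/
def IsPlateau (ν : AddValuation K[X] (WithTop Γ)) (S : Set K[X]) : Prop :=
  S.Nonempty ∧ ¬ ∃ q ∈ S, ∀ q' ∈ S, ν q' ≤ ν q

/-- `f` is `S`-stable if `ν_q f = ν f` for some `q ∈ S`. -/
def IsStable (ν : AddValuation K[X] (WithTop Γ)) (S : Set K[X]) (f : K[X]) : Prop :=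
  ∃ q ∈ S, truncation ν q f = ν f

/-- A limit key polynomial for `S`: a monic `S`-unstable polynomial of the smallest degree
among the `S`-unstable polynomials. -/
def IsLimitKeyPolynomial (ν : AddValuation K[X] (WithTop Γ)) (S : Set K[X]) (F : K[X]) : Prop :=
  F.Monic ∧ ¬ IsStable ν S F ∧ ∀ f : K[X], ¬ IsStable ν S f → F.natDegree ≤ f.natDegree

/-- The lower cut set `δ^L`: the smallest initial segment of `Γ` that contains all values
`ν_q F`, `q ∈ S`. -/
def lowerCut (ν : AddValuation K[X] (WithTop Γ)) (S : Set K[X]) (F : K[X]) : LowerSet Γ :=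
  lowerClosure {γ : Γ | ∃ q ∈ S, truncation ν q F = (γ : WithTop Γ)}

/-- The set `B(F)` of those `b ∈ {1, ..., D - 1}` for which `ν (a_{Q b} Q ^ b) ∈ δ^L` for every
`Q ∈ S` of large enough value, where `F = a_{Q 0} + a_{Q 1} Q + ... + a_{Q D} Q ^ D` is the
`Q`-expansion. The elements of `S` all have degree `n`, so `D` is the integer part of
`deg F / n`. -/
def indexSet (ν : AddValuation K[X] (WithTop Γ)) (S : Set K[X]) (n : ℕ) (F : K[X]) : Set ℕ :=
  {b | 1 ≤ b ∧ b < F.natDegree / n ∧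
    ∃ q₀ ∈ S, ∀ q ∈ S, ν q₀ ≤ ν q →
      ∃ γ ∈ lowerCut ν S F, ν (expCoeff q F b * q ^ b) = (γ : WithTop Γ)}

variable {Kbar : Type*} [Field Kbar] [Algebra K Kbar]

/-- `ε(f)`, the maximum of `νbar (x - a)` over the roots `a` of `f` in `Kbar` (`f` nonconstant;
the added bottom element is the value at constants, where there is no root). -/
def eps (νbar : AddValuation Kbar[X] (WithTop Γ)) (f : K[X]) : WithBot (WithTop Γ) :=
  ((f.aroots Kbar).map fun a => ((νbar (X - C a) : WithTop Γ) : WithBot (WithTop Γ))).sup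

/-- `Q` is a key polynomial: it is monic, nonconstant, and `ε(f) < ε(Q)` for all nonconstant
`f` of degree less than `deg Q`. -/
def IsKeyPolynomial (νbar : AddValuation Kbar[X] (WithTop Γ)) (Q : K[X]) : Prop :=
  Q.Monic ∧ 1 ≤ Q.natDegree ∧
    ∀ f : K[X], 1 ≤ f.natDegree → f.natDegree < Q.natDegree → eps νbar f < eps νbar Q

/-- A (complete) sequence of key polynomials for `ν`, indexed by a well-ordered set `I`. -/
structure IsKeyPolynomialSequence (ν : AddValuation K[X] (WithTop Γ))
    (νbar : AddValuation Kbar[X] (WithTop Γ)) {I : Type*} [LinearOrder I] (Q : I → K[X]) :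
    Prop where
  wellOrdered : WellFoundedLT I
  isKeyPolynomial : ∀ i, IsKeyPolynomial νbar (Q i)
  eps_monotone : Monotone fun i => eps νbar (Q i)
  isComplete : IsComplete ν (Set.range Q)

end Expansions

/-- The valuation `ν` on `K[x]` with `ν f = v (f(η))`. Its support is generated by the minimal
polynomial `g` of `η`, and `ν f = v (f_0(η))` in terms of the `g`-expansion `f = ∑ f_i g ^ i`. -/
abbrev polyVal {K L Γ : Type*} [Field K] [Field L] [Algebra K L]
    [AddCommGroup Γ] [LinearOrder Γ] [IsOrderedAddMonoid Γ]
    (v : AddValuation L (WithTop Γ)) (η : L) : AddValuation K[X] (WithTop Γ) :=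
  v.comap (aeval η : K[X] →ₐ[K] L).toRingHom

end

end KeyPol

/-! Write ν_a for the truncation at x - a and g for the minimal polynomial of η. Since the values
v(η - a) have no maximum, each equals v(b - a) for a better centre b, so there is c_a in K with
v(c_a) = v(η - a). Hence ν_a is the Gauss valuation after the substitution x = c_a t + a
(`truncation_X_sub_C`), it grows with v(η - a) and never exceeds ν. As no key polynomial has degree
strictly between 1 and deg g, completeness makes every f of degree < deg g satisfy ν_a(f) = ν(f) for
some a, while ν_a(g) < ∞ = ν(g). So limit key polynomials exist and are the unstable F = g + h with
deg h < deg g.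

Both sides of the equivalence amount to the condition (*): for every a there is b with v(g'(η)) +
v(η - a) ≤ ν_b(g).

Differentials: O_L is the union of the rings O_K[z_a], z_a = (η - a)/c_a. Rescaling g to be
primitive in z_b gives a relation that kills dz_b by an element of value v(g'(η)) + v(c_b) - ν_b(g),
and dz_a = (c_b/c_a) dz_b for b beyond a; under (*) this vanishes (`D_eq_zero_of_le`). Conversely
f(η) ↦ f'(η) is a derivation of O_L modulo the elements of value at least v(g'(η)) - ν_b(g) for some
b, and its vanishing at all z_a is (*).

Index set: the coefficient of index 1 of F at x - a is g'(a) + h'(a). Eventually v(g'(a)) =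
v(g'(η)), and the contribution of h has value at least v(h(η)) = ν(F), above every ν_b(F). Thus only
g matters, which gives (*) (`one_mem_indexSet_iff`). -/

namespace KeyPol

noncomputable section

/-! ### Gauss valuations and Taylor expansions -/

section Gauss

variable {K Γ : Type*} [Field K] [AddCommGroup Γ] [LinearOrder Γ] [IsOrderedAddMonoid Γ]

/-- The minimum of the values of the coefficients of a polynomial. -/
def coeffInf (u : AddValuation K (WithTop Γ)) (p : K[X]) : WithTop Γ :=
  p.support.inf fun i => u (p.coeff i)

theorem le_coeffInf_iff {u : AddValuation K (WithTop Γ)} {p : K[X]} {γ : WithTop Γ} :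
    γ ≤ coeffInf u p ↔ ∀ i, γ ≤ u (p.coeff i) := by
  rw [coeffInf, Finset.le_inf_iff]
  refine ⟨fun h i => ?_, fun h i _ => h i⟩
  by_cases hi : p.coeff i = 0
  · simp [hi]
  · exact h i (mem_support_iff.2 hi)

theorem coeffInf_le (u : AddValuation K (WithTop Γ)) (p : K[X]) (i : ℕ) :
    coeffInf u p ≤ u (p.coeff i) :=
  le_coeffInf_iff.1 le_rfl i

theorem coeffInf_zero (u : AddValuation K (WithTop Γ)) : coeffInf u 0 = ⊤ := by
  simp [coeffInf]

theorem exists_first_eq_coeffInf (u : AddValuation K (WithTop Γ)) {p : K[X]} (hp : p ≠ 0) :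
    ∃ i, u (p.coeff i) = coeffInf u p ∧ ∀ k < i, coeffInf u p < u (p.coeff k) := by
  classical
  have h : ∃ i, u (p.coeff i) = coeffInf u p := by
    obtain ⟨i, -, hi⟩ := Finset.exists_mem_eq_inf p.support (nonempty_support_iff.2 hp)
      fun i => u (p.coeff i)
    exact ⟨i, hi.symm⟩
  exact ⟨Nat.find h, Nat.find_spec h, fun k hk =>
    lt_of_le_of_ne (coeffInf_le u p k) (Ne.symm (Nat.find_min h hk))⟩

theorem coeffInf_ne_top (u : AddValuation K (WithTop Γ)) {p : K[X]} (hp : p ≠ 0) :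
    coeffInf u p ≠ ⊤ := fun h => hp <| by
  ext i
  rw [coeff_zero]
  exact (AddValuation.top_iff u).1 (top_le_iff.1 (h ▸ coeffInf_le u p i))

/-- Gauss's lemma: if i and j are the first indices where the minima are attained, then in the
coefficient of index i + j the product of these two coefficients is the unique term of least value.
-/
theorem coeffInf_mul (u : AddValuation K (WithTop Γ)) (p q : K[X]) :
    coeffInf u (p * q) = coeffInf u p + coeffInf u q := by
  by_cases hp : p = 0
  · simp [hp, coeffInf_zero]
  by_cases hq : q = 0
  · simp [hq, coeffInf_zero]
  refine le_antisymm ?_ (le_coeffInf_iff.2 fun n => ?_)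
  · obtain ⟨i, hi, hi'⟩ := exists_first_eq_coeffInf u hp
    obtain ⟨j, hj, hj'⟩ := exists_first_eq_coeffInf u hq
    have hpt := coeffInf_ne_top u hp
    have hqt := coeffInf_ne_top u hq
    have hmem : (i, j) ∈ Finset.HasAntidiagonal.antidiagonal (i + j) := by simp
    have hij : u (p.coeff i * q.coeff j) = coeffInf u p + coeffInf u q := by
      rw [AddValuation.map_mul, hi, hj]
    have hrest : u (p.coeff i * q.coeff j) <
        u (∑ x ∈ (Finset.HasAntidiagonal.antidiagonal (i + j)).erase (i, j), p.coeff x.1 * q.coeff x.2) := by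
      refine AddValuation.map_lt_sum _ (by rw [hij]; exact WithTop.add_ne_top.2 ⟨hpt, hqt⟩) ?_
      rintro ⟨k, l⟩ hkl
      simp only [Finset.mem_erase, Finset.HasAntidiagonal.mem_antidiagonal, ne_eq, Prod.mk.injEq] at hkl
      rw [hij, AddValuation.map_mul]
      rcases lt_or_ge k i with hk | hk
      · exact WithTop.add_lt_add_of_lt_of_le hqt (hi' k hk) (coeffInf_le u q l)
      · exact WithTop.add_lt_add_of_le_of_lt hpt (coeffInf_le u p k) (hj' l (by omega))
    refine (coeffInf_le u _ (i + j)).trans ?_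
    rw [coeff_mul, ← Finset.add_sum_erase _ _ hmem,
      AddValuation.map_add_eq_of_lt_left _ hrest, hij]
  · rw [coeff_mul]
    refine AddValuation.map_le_sum _ fun x _ => ?_
    rw [AddValuation.map_mul]
    exact add_le_add (coeffInf_le u p _) (coeffInf_le u q _)

/-- The Gauss valuation on `K[x]`. -/
def gaussVal (u : AddValuation K (WithTop Γ)) : AddValuation K[X] (WithTop Γ) :=
  AddValuation.of (coeffInf u) (coeffInf_zero u)
    (le_antisymm (by simpa using coeffInf_le u 1 0) (le_coeffInf_iff.2 fun i => by
      rw [coeff_one]; split_ifs <;> simp))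
    (fun p q => le_coeffInf_iff.2 fun i => by
      rw [coeff_add]
      exact (min_le_min (coeffInf_le u p i) (coeffInf_le u q i)).trans (u.map_add _ _))
    (coeffInf_mul u)

theorem le_gaussVal_iff {u : AddValuation K (WithTop Γ)} {p : K[X]} {γ : WithTop Γ} :
    γ ≤ gaussVal u p ↔ ∀ i, γ ≤ u (p.coeff i) :=
  le_coeffInf_iff

theorem gaussVal_le (u : AddValuation K (WithTop Γ)) (p : K[X]) (i : ℕ) :
    gaussVal u p ≤ u (p.coeff i) :=
  coeffInf_le u p i

theorem gaussVal_ne_top (u : AddValuation K (WithTop Γ)) {p : K[X]} (hp : p ≠ 0) :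
    gaussVal u p ≠ ⊤ :=
  coeffInf_ne_top u hp

theorem exists_eq_gaussVal (u : AddValuation K (WithTop Γ)) {p : K[X]} (hp : p ≠ 0) :
    ∃ i, u (p.coeff i) = gaussVal u p :=
  (exists_first_eq_coeffInf u hp).imp fun _ h => h.1

theorem gaussVal_C (u : AddValuation K (WithTop Γ)) (a : K) : gaussVal u (C a) = u a :=
  le_antisymm (by simpa using gaussVal_le u (C a) 0) (le_gaussVal_iff.2 fun i => by
    rw [coeff_C]; split_ifs <;> simp)

theorem gaussVal_X (u : AddValuation K (WithTop Γ)) : gaussVal u X = 0 :=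
  le_antisymm (by simpa using gaussVal_le u X 1) (le_gaussVal_iff.2 fun i => by
    rw [coeff_X]; split_ifs <;> simp)

/-- The Gauss valuation is the least extension giving the variable a nonnegative value. Taking `R`
to be `L` compares truncations with ν; taking `R` to be `K[X]` compares truncations at two centres.
-/
theorem gaussVal_le_map_eval₂ {R : Type*} [CommRing R] (u : AddValuation K (WithTop Γ))
    (w : AddValuation R (WithTop Γ)) (φ : K →+* R) (hφ : ∀ a, w (φ a) = u a) (p : K[X]) {y : R}
    (hy : 0 ≤ w y) : gaussVal u p ≤ w (p.eval₂ φ y) := by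
  rw [eval₂_eq_sum, Polynomial.sum]
  refine AddValuation.map_le_sum _ fun i _ => ?_
  rw [AddValuation.map_mul, AddValuation.map_pow, hφ]
  exact (gaussVal_le u p i).trans (le_add_of_nonneg_right (nsmul_nonneg hy i))

theorem expCoeff_X_sub_C (a : K) (f : K[X]) (i : ℕ) :
    expCoeff (X - C a) f i = C ((taylor a f).coeff i) := by
  induction i generalizing f with
  | zero => simp [expCoeff, modByMonic_X_sub_C_eq_C_eval]
  | succ i ih =>
    have h : expCoeff (X - C a) f (i + 1) = expCoeff (X - C a) (f /ₘ (X - C a)) i := by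
      simp [expCoeff, Function.iterate_succ_apply]
    rw [h, ih]
    congr 1
    conv_rhs => rw [← modByMonic_add_div f (X - C a)]
    rw [modByMonic_X_sub_C_eq_C_eval, map_add, taylor_mul]
    simp [taylor_C, taylor_X]

theorem comp_C_mul_X_add_C_coeff (a c : K) (f : K[X]) (i : ℕ) :
    (f.comp (C c * X + C a)).coeff i = (taylor a f).coeff i * c ^ i := by
  rw [← comp_C_mul_X_coeff, taylor_apply, comp_assoc]
  simp

end Gauss

/-! ### Linear truncations as Gauss valuations -/

section Truncation

variable {K L Γ : Type*} [Field K] [Field L] [Algebra K L]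
  [AddCommGroup Γ] [LinearOrder Γ] [IsOrderedAddMonoid Γ]
  (v : AddValuation L (WithTop Γ)) (η : L)

theorem polyVal_apply (f : K[X]) : polyVal v η f = v (aeval η f) := rfl

theorem restrict_apply (a : K) : restrict K v a = v (algebraMap K L a) := rfl

theorem polyVal_X_sub_C (a : K) :
    polyVal v η (X - C a : K[X]) = v (η - algebraMap K L a) := by
  simp [polyVal_apply]

theorem polyVal_expCoeff (a : K) (f : K[X]) (i : ℕ) :
    polyVal v η (expCoeff (X - C a) f i * (X - C a) ^ i) =
      restrict K v ((taylor a f).coeff i) + i • v (η - algebraMap K L a) := by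
  rw [expCoeff_X_sub_C, AddValuation.map_mul, AddValuation.map_pow, polyVal_X_sub_C,
    polyVal_apply, aeval_C, restrict_apply]

theorem truncation_X_sub_C {a c : K} (hc : restrict K v c = v (η - algebraMap K L a))
    (f : K[X]) : truncation (polyVal v η) (X - C a) f =
      gaussVal (restrict K v) (f.comp (C c * X + C a)) := by
  have h : ∀ i, polyVal v η (expCoeff (X - C a) f i * (X - C a) ^ i) =
      restrict K v ((f.comp (C c * X + C a)).coeff i) := fun i => by
    rw [polyVal_expCoeff, comp_C_mul_X_add_C_coeff, AddValuation.map_mul, AddValuation.map_pow,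
      hc]
  refine eq_of_forall_le_iff fun γ => ?_
  rw [truncation, Finset.le_inf_iff, le_gaussVal_iff]
  refine ⟨fun H i => ?_, fun H i _ => (H i).trans_eq (h i).symm⟩
  -- The truncation only ranges over indices up to the degree; beyond it the Taylor coefficients
  -- vanish and have value ⊤.
  by_cases hi : i < f.natDegree + 1
  · exact (H i (Finset.mem_range.2 hi)).trans_eq (h i)
  · rw [comp_C_mul_X_add_C_coeff, coeff_eq_zero_of_natDegree_lt (by rw [natDegree_taylor]; omega)]
    simp

end Truncation

/-! ### Dependence of linear truncations on the centre -/

section LinearTruncation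

variable {K L Γ : Type*} [Field K] [Field L] [Algebra K L]
  [AddCommGroup Γ] [LinearOrder Γ] [IsOrderedAddMonoid Γ]
  {v : AddValuation L (WithTop Γ)} {η : L}

theorem map_div_nonneg {F : Type*} [Field F] (u : AddValuation F (WithTop Γ)) {x c : F}
    (hc : c ≠ 0) (h : u c ≤ u x) : 0 ≤ u (x / c) := by
  have h1 : u x = u (x / c) + u c := by rw [← AddValuation.map_mul, div_mul_cancel₀ _ hc]
  have h2 : u c ≠ ⊤ := fun h => hc ((AddValuation.top_iff u).1 h)
  rw [h1] at h
  exact (WithTop.add_le_add_iff_right h2).1 (by simpa using h)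

theorem map_div_pos {F : Type*} [Field F] (u : AddValuation F (WithTop Γ)) {x c : F}
    (hc : c ≠ 0) (h : u c < u x) : 0 < u (x / c) := by
  have h1 : u x = u (x / c) + u c := by rw [← AddValuation.map_mul, div_mul_cancel₀ _ hc]
  have h2 : u c ≠ ⊤ := fun h => hc ((AddValuation.top_iff u).1 h)
  rw [h1] at h
  exact (WithTop.add_lt_add_iff_right h2).1 (by simpa using h)

/-- For a strictly better centre b, b - a differs from η - a by the element η - b of larger value,
so c = b - a works. -/
theorem exists_restrict_eq (hno : ∀ a : K, ∃ b : K,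
    v (η - algebraMap K L a) < v (η - algebraMap K L b)) (a : K) :
    ∃ c : K, c ≠ 0 ∧ restrict K v c = v (η - algebraMap K L a) := by
  obtain ⟨b, hb⟩ := hno a
  have h : restrict K v (b - a) = v (η - algebraMap K L a) := by
    have : algebraMap K L (b - a) = (η - algebraMap K L a) - (η - algebraMap K L b) := by
      rw [map_sub]; ring
    rw [restrict_apply, this, AddValuation.map_sub_eq_of_lt_left _ hb]
  refine ⟨b - a, fun h0 => ?_, h⟩
  rw [h0, AddValuation.map_zero] at h
  exact not_top_lt (h ▸ hb)

theorem restrict_sub_ge {a b c : K} (hc : restrict K v c = v (η - algebraMap K L a))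
    (h : v (η - algebraMap K L a) ≤ v (η - algebraMap K L b)) :
    restrict K v c ≤ restrict K v (b - a) := by
  have : algebraMap K L (b - a) = (η - algebraMap K L a) - (η - algebraMap K L b) := by
    rw [map_sub]; ring
  rw [restrict_apply v (b - a), this, hc]
  exact AddValuation.map_le_sub _ le_rfl h

theorem comp_affine_eq_eval₂ {a b c c' : K} (hc : c ≠ 0) (f : K[X]) :
    f.comp (C c' * X + C b) = (f.comp (C c * X + C a)).eval₂ C
      (C (c' / c) * X + C ((b - a) / c)) := by
  change _ = (f.comp (C c * X + C a)).comp _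
  rw [comp_assoc]
  congr 1
  simp only [add_comp, mul_comp, C_comp, X_comp, mul_add, ← mul_assoc, ← C_mul]
  rw [mul_div_cancel₀ _ hc, mul_div_cancel₀ _ hc, add_assoc, ← C_add, sub_add_cancel]

theorem aeval_eq_eval₂_comp_affine {a c : K} (hc : c ≠ 0) (f : K[X]) :
    aeval η f = (f.comp (C c * X + C a)).eval₂ (algebraMap K L)
      ((η - algebraMap K L a) / algebraMap K L c) := by
  have hc' : algebraMap K L c ≠ 0 := by simpa using hc
  rw [← aeval_def, aeval_comp]
  congr 1
  simp [mul_div_cancel₀ _ hc']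

theorem map_div_eq_zero {a c : K} (hc : c ≠ 0)
    (h : restrict K v c = v (η - algebraMap K L a)) :
    v ((η - algebraMap K L a) / algebraMap K L c) = 0 := by
  have hc' : algebraMap K L c ≠ 0 := by simpa using hc
  have hx : η - algebraMap K L a ≠ 0 := fun h0 => hc <| by
    rw [h0, AddValuation.map_zero] at h
    exact (AddValuation.top_iff _).1 h
  have h1 := map_div_nonneg v hc' h.le
  have h2 := map_div_nonneg v hx h.ge
  refine le_antisymm ?_ h1
  have h3 := AddValuation.map_mul v ((η - algebraMap K L a) / algebraMap K L c)
    (algebraMap K L c / (η - algebraMap K L a))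
  rw [div_mul_div_cancel₀ hc', div_self hx, AddValuation.map_one] at h3
  rw [h3]
  exact le_add_of_nonneg_right h2

variable (hno : ∀ a : K, ∃ b : K, v (η - algebraMap K L a) < v (η - algebraMap K L b))
include hno

/-- Passing from a to b substitutes (c'/c) t + (b - a)/c for t, and both coefficients are integral.
-/
theorem truncation_mono {a b : K} (h : v (η - algebraMap K L a) ≤ v (η - algebraMap K L b))
    (f : K[X]) :
    truncation (polyVal v η) (X - C a) f ≤ truncation (polyVal v η) (X - C b) f := by
  obtain ⟨c, hc0, hc⟩ := exists_restrict_eq hno a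
  obtain ⟨c', -, hc'⟩ := exists_restrict_eq hno b
  rw [truncation_X_sub_C v η hc, truncation_X_sub_C v η hc',
    comp_affine_eq_eval₂ (a := a) (b := b) (c' := c') hc0 f]
  refine gaussVal_le_map_eval₂ (restrict K v) (gaussVal (restrict K v)) C (gaussVal_C _) _
    (AddValuation.map_le_add _ ?_ ?_)
  · rw [AddValuation.map_mul, gaussVal_C, gaussVal_X, add_zero]
    exact map_div_nonneg _ hc0 (by rw [hc, hc']; exact h)
  · rw [gaussVal_C]
    exact map_div_nonneg _ hc0 (restrict_sub_ge hc h)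

theorem truncation_le_map_aeval (a : K) (f : K[X]) :
    truncation (polyVal v η) (X - C a) f ≤ v (aeval η f) := by
  obtain ⟨c, hc0, hc⟩ := exists_restrict_eq hno a
  rw [truncation_X_sub_C v η hc, aeval_eq_eval₂_comp_affine hc0 f]
  exact gaussVal_le_map_eval₂ _ _ _ (fun _ => rfl) _ (map_div_eq_zero hc0 hc).ge

/-- Gives access to multiplicativity and the ultrametric rules for truncations. -/
theorem exists_addValuation_eq_truncation (a : K) : ∃ w : AddValuation K[X] (WithTop Γ),
    ∀ f, truncation (polyVal v η) (X - C a) f = w f := by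
  obtain ⟨c, -, hc⟩ := exists_restrict_eq hno a
  exact ⟨(gaussVal (restrict K v)).comap (compRingHom (C c * X + C a)),
    fun f => truncation_X_sub_C v η hc f⟩

theorem truncation_ne_top (a : K) {f : K[X]} (hf : f ≠ 0) :
    truncation (polyVal v η) (X - C a) f ≠ ⊤ := by
  obtain ⟨c, hc0, hc⟩ := exists_restrict_eq hno a
  rw [truncation_X_sub_C v η hc]
  refine gaussVal_ne_top _ fun h => hf ?_
  -- Centre 0 and scale 1 undo the affine substitution and recover `f`.
  have h1 := comp_affine_eq_eval₂ (a := a) (b := 0) (c' := 1) hc0 f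
  simpa [h] using h1

theorem truncation_le_map_eval_derivative (a : K) (f : K[X]) :
    truncation (polyVal v η) (X - C a) f ≤
      restrict K v (f.derivative.eval a) + v (η - algebraMap K L a) := by
  obtain ⟨c, -, hc⟩ := exists_restrict_eq hno a
  rw [truncation_X_sub_C v η hc, ← hc, ← AddValuation.map_mul]
  have := gaussVal_le (restrict K v) (f.comp (C c * X + C a)) 1
  rwa [comp_C_mul_X_add_C_coeff, taylor_coeff_one, pow_one] at this

omit hno in
theorem map_le_map_pow_sub_pow {x y : L} (hx : 0 ≤ v x) (hy : 0 ≤ v y) (i : ℕ) :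
    v (x - y) ≤ v (x ^ i - y ^ i) := by
  rw [← (Commute.all x y).geom_sum₂_mul, AddValuation.map_mul]
  refine le_add_of_nonneg_left (AddValuation.map_le_sum _ fun j _ => ?_)
  rw [AddValuation.map_mul, AddValuation.map_pow, AddValuation.map_pow]
  exact add_nonneg (nsmul_nonneg hx _) (nsmul_nonneg hy _)

omit hno in
theorem gaussVal_add_le_map_sub (p : K[X]) {x y : L} (hx : 0 ≤ v x) (hy : 0 ≤ v y) :
    gaussVal (restrict K v) p + v (x - y) ≤ v (aeval x p - aeval y p) := by
  rw [aeval_eq_sum_range, aeval_eq_sum_range, ← Finset.sum_sub_distrib]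
  refine AddValuation.map_le_sum _ fun i _ => ?_
  rw [← smul_sub, Algebra.smul_def, AddValuation.map_mul]
  exact add_le_add (gaussVal_le _ p i) (map_le_map_pow_sub_pow hx hy i)

/-- In the normalized variable at a, the points belonging to η and b differ by (η - b)/c, of
positive value. So f(η) - f(b) has value greater than ν_a(f) = v(f(η)). -/
theorem map_eval_eq_of_truncation_eq {a b : K} {f : K[X]}
    (hf : truncation (polyVal v η) (X - C a) f = v (aeval η f))
    (h : v (η - algebraMap K L a) < v (η - algebraMap K L b)) :
    restrict K v (f.eval b) = v (aeval η f) := by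
  by_cases hf0 : f = 0
  · simp [hf0]
  obtain ⟨c, hc0, hc⟩ := exists_restrict_eq hno a
  have hc' : algebraMap K L c ≠ 0 := by simpa using hc0
  have hft := truncation_ne_top hno a hf0
  rw [hf] at hft
  rw [truncation_X_sub_C v η hc] at hf
  set p := f.comp (C c * X + C a) with hp
  have h1 : aeval η f = aeval ((η - algebraMap K L a) / algebraMap K L c) p :=
    aeval_eq_eval₂_comp_affine hc0 f
  have h2 : algebraMap K L (f.eval b) = aeval (algebraMap K L ((b - a) / c)) p := by
    rw [← aeval_algebraMap_apply_eq_algebraMap_eval, hp, aeval_comp]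
    congr 1
    simp [mul_div_cancel₀ _ hc']
  have hy : 0 ≤ v (algebraMap K L ((b - a) / c)) :=
    map_div_nonneg (restrict K v) hc0 (restrict_sub_ge hc h.le)
  have h3 := gaussVal_add_le_map_sub (v := v) p (map_div_eq_zero hc0 hc).ge hy
  have h4 : 0 < v ((η - algebraMap K L a) / algebraMap K L c -
      algebraMap K L ((b - a) / c)) := by
    have : (η - algebraMap K L a) / algebraMap K L c - algebraMap K L ((b - a) / c) =
        (η - algebraMap K L b) / algebraMap K L c := by
      rw [map_div₀, map_sub]; ring
    rw [this]
    exact map_div_pos v hc' (by rw [← hc] at h; exact h)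
  rw [← h1, ← h2, hf] at h3
  have h5 : v (aeval η f) < v (algebraMap K L (f.eval b) - aeval η f) := by
    rw [AddValuation.map_sub_swap]
    refine lt_of_lt_of_le ?_ h3
    simpa using WithTop.add_lt_add_of_le_of_lt hft (le_refl (v (aeval η f))) h4
  exact AddValuation.map_eq_of_lt_sub v h5

end LinearTruncation

/-! ### Kähler differentials of the valuation rings -/

section Differentials

variable {K L Γ : Type*} [Field K] [Field L] [Algebra K L]
  [AddCommGroup Γ] [LinearOrder Γ] [IsOrderedAddMonoid Γ]
  {v : AddValuation L (WithTop Γ)} {η : L}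

theorem exists_reduced (hη : IsIntegral K η) (hL : IntermediateField.adjoin K {η} = ⊤) (y : L) :
    ∃ f : K[X], f.degree < (minpoly K η).degree ∧ aeval η f = y := by
  have hy : y ∈ (IntermediateField.adjoin K {η}).toSubalgebra := by rw [hL]; trivial
  rw [IntermediateField.adjoin_simple_toSubalgebra_of_isAlgebraic hη.isAlgebraic,
    Algebra.adjoin_singleton_eq_range_aeval] at hy
  obtain ⟨f, rfl⟩ := hy
  exact ⟨f %ₘ minpoly K η, degree_modByMonic_lt _ (minpoly.monic hη),
    by simp [modByMonic_eq_sub_mul_div]⟩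

theorem eq_of_aeval_eq {f h : K[X]}
    (hf : f.degree < (minpoly K η).degree) (hh : h.degree < (minpoly K η).degree)
    (H : aeval η f = aeval η h) : f = h := by
  by_contra hne
  have h0 : f - h ≠ 0 := sub_ne_zero.2 hne
  have := minpoly.degree_le_of_ne_zero K η h0 (by simp [H])
  exact absurd (this.trans (degree_sub_le f h)) (not_le.2 (max_lt hf hh))

theorem one_lt_natDegree_minpoly (hη : IsIntegral K η)
    (hno : ∀ a : K, ∃ b : K, v (η - algebraMap K L a) < v (η - algebraMap K L b)) :
    1 < (minpoly K η).natDegree := by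
  refine lt_of_le_of_ne (minpoly.natDegree_pos hη) fun h => ?_
  obtain ⟨a, ha⟩ := minpoly.natDegree_eq_one_iff.1 h.symm
  obtain ⟨b, hb⟩ := hno a
  simp [ha] at hb

theorem exists_map_eq_of_gaussVal_nonneg {u : AddValuation K (WithTop Γ)} {p : K[X]}
    (hp : 0 ≤ gaussVal u p) : ∃ P : (valRing u)[X], P.map (valRing u).subtype = p := by
  have h : (p.coeffs : Set K) ⊆ valRing u := by
    intro x hx
    obtain ⟨i, -, rfl⟩ := mem_coeffs_iff.1 hx
    exact le_gaussVal_iff.1 hp i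
  exact ⟨p.toSubring _ h, by ext i; simp⟩

theorem coe_algebraMap_valRing (r : valRing (restrict K v)) :
    ((algebraMap (valRing (restrict K v)) (valRing v) r : valRing v) : L) =
      algebraMap K L r := rfl

theorem coe_aeval_valRing (P : (valRing (restrict K v))[X]) (y : valRing v) :
    ((aeval y P : valRing v) : L) = aeval (y : L) (P.map (valRing (restrict K v)).subtype) := by
  rw [aeval_def, aeval_def, eval₂_map]
  exact hom_eval₂ P _ (valRing v).subtype y

theorem exists_common_bound {ι : Type*} {M : Type*} [LinearOrder M] (w : ι → M) (a b : ι) :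
    ∃ c, w a ≤ w c ∧ w b ≤ w c := by
  rcases le_total (w a) (w b) with h | h
  · exact ⟨b, h, le_rfl⟩
  · exact ⟨a, le_rfl, h⟩

/-- Every element of the valuation ring is a polynomial with coefficients in the valuation ring
of `K` in a normalization of `η - a`. -/
theorem exists_aeval_eq (hη : IsIntegral K η) (hL : IntermediateField.adjoin K {η} = ⊤)
    (hno : ∀ a : K, ∃ b : K, v (η - algebraMap K L a) < v (η - algebraMap K L b))
    (hst : ∀ f : K[X], f.degree < (minpoly K η).degree →
      ∃ a : K, truncation (polyVal v η) (X - C a) f = v (aeval η f)) (y : valRing v) :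
    ∃ a c : K, ∃ z : valRing v, c ≠ 0 ∧ restrict K v c = v (η - algebraMap K L a) ∧
      (z : L) = (η - algebraMap K L a) / algebraMap K L c ∧
      ∃ P : (valRing (restrict K v))[X], aeval z P = y := by
  obtain ⟨f, hf, hfy⟩ := exists_reduced hη hL (y : L)
  obtain ⟨a, ha⟩ := hst f hf
  obtain ⟨c, hc0, hc⟩ := exists_restrict_eq hno a
  have hy : 0 ≤ v (y : L) := y.2
  rw [truncation_X_sub_C v η hc, hfy] at ha
  obtain ⟨P, hP⟩ := exists_map_eq_of_gaussVal_nonneg (ha.symm ▸ hy)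
  refine ⟨a, c, ⟨_, (map_div_eq_zero hc0 hc).ge⟩, hc0, hc, rfl, P, Subtype.ext ?_⟩
  rw [coe_aeval_valRing, hP, ← hfy, aeval_eq_eval₂_comp_affine hc0 f]
  rfl

/-- Dividing the minimal polynomial, written in z' = (η - b)/c', by a coefficient d of least value
yields an integral P with P(z') = 0, hence P'(z') dz' = 0. Since dz = (c'/c) dz', it suffices that
P'(z') divides c'/c, which is what the inequality `hb` says. -/
theorem D_eq_zero_of_le
    (hno : ∀ a : K, ∃ b : K, v (η - algebraMap K L a) < v (η - algebraMap K L b))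
    (hη : IsIntegral K η) {a b c : K} (z : valRing v) (hc0 : c ≠ 0)
    (hc : restrict K v c = v (η - algebraMap K L a))
    (hz : (z : L) = (η - algebraMap K L a) / algebraMap K L c)
    (hab : v (η - algebraMap K L a) ≤ v (η - algebraMap K L b))
    (hb : v (aeval η (minpoly K η).derivative) + v (η - algebraMap K L a) ≤
      truncation (polyVal v η) (X - C b) (minpoly K η)) :
    KaehlerDifferential.D (valRing (restrict K v)) (valRing v) z = 0 := by
  obtain ⟨c', hc0', hc'⟩ := exists_restrict_eq hno b
  have hcL : algebraMap K L c ≠ 0 := by simpa using hc0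
  have hcL' : algebraMap K L c' ≠ 0 := by simpa using hc0'
  have hg0 : minpoly K η ≠ 0 := minpoly.ne_zero hη
  have hgt := truncation_ne_top hno b hg0
  have hg' : aeval η (minpoly K η).derivative ≠ 0 := fun h => hgt <| by
    rw [h, AddValuation.map_zero, top_add] at hb
    exact top_le_iff.1 hb
  set p := (minpoly K η).comp (C c' * X + C b) with hp
  rw [truncation_X_sub_C v η hc'] at hb hgt
  have hp0 : p ≠ 0 := fun h => hgt (by rw [← hp, h, AddValuation.map_zero])
  obtain ⟨i, hi⟩ := exists_eq_gaussVal (restrict K v) hp0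
  set d := p.coeff i with hd
  have hd0 : d ≠ 0 := fun h => hgt (by rw [← hp, ← hi, h, AddValuation.map_zero])
  have hdL : algebraMap K L d ≠ 0 := by simpa using hd0
  obtain ⟨P, hP⟩ : ∃ P : (valRing (restrict K v))[X],
      P.map (valRing (restrict K v)).subtype = C d⁻¹ * p := by
    refine exists_map_eq_of_gaussVal_nonneg (le_gaussVal_iff.2 fun j => ?_)
    rw [coeff_C_mul, inv_mul_eq_div]
    exact map_div_nonneg _ hd0 (hi.trans_le (gaussVal_le _ p j))
  let z' : valRing v := ⟨_, (map_div_eq_zero hc0' hc').ge⟩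
  let r : valRing (restrict K v) := ⟨c' / c, map_div_nonneg _ hc0 (by rw [hc, hc']; exact hab)⟩
  let s : valRing (restrict K v) := ⟨(b - a) / c, map_div_nonneg _ hc0 (restrict_sub_ge hc hab)⟩
  -- This is the quotient of c'/c by P'(z') = c' g'(η)/d.
  let e : valRing v := ⟨algebraMap K L d / (algebraMap K L c * aeval η (minpoly K η).derivative),
    map_div_nonneg _ (mul_ne_zero hcL hg') (by
      rw [AddValuation.map_mul, add_comm]
      exact (hc ▸ hb).trans_eq hi.symm)⟩
  have hz'P : aeval z' P = 0 := by
    apply Subtype.ext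
    rw [coe_aeval_valRing, hP, map_mul]
    have : aeval (z' : L) p = 0 := by
      rw [← minpoly.aeval K η, aeval_eq_eval₂_comp_affine hc0' (minpoly K η)]
      rfl
    rw [this, mul_zero]
    rfl
  have hz'P' : ((aeval z' P.derivative : valRing v) : L) =
      (algebraMap K L d)⁻¹ * (algebraMap K L c' * aeval η (minpoly K η).derivative) := by
    rw [coe_aeval_valRing, ← derivative_map, hP, derivative_C_mul, hp, derivative_comp]
    rw [aeval_eq_eval₂_comp_affine (a := b) hc0' (derivative (minpoly K η))]
    simp [aeval_def, z']
  have hzz' : z = aeval z' (C r * X + C s) := by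
    apply Subtype.ext
    rw [coe_aeval_valRing, hz]
    simp only [Polynomial.map_add, Polynomial.map_mul, map_C, map_X, map_add, map_mul, aeval_C,
      aeval_X, z', r, s, Subring.subtype_apply, map_div₀, map_sub]
    field_simp
    ring
  have hre : algebraMap (valRing (restrict K v)) (valRing v) r = e * aeval z' P.derivative := by
    apply Subtype.ext
    rw [coe_algebraMap_valRing, Subring.coe_mul, hz'P']
    simp only [r, e, map_div₀]
    field_simp
  have h1 := Derivation.map_aeval (KaehlerDifferential.D (valRing (restrict K v)) (valRing v)) P z'
  rw [hz'P, map_zero] at h1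
  rw [hzz', Derivation.map_aeval]
  have h2 : aeval z' (C r * X + C s).derivative =
      algebraMap (valRing (restrict K v)) (valRing v) r := by simp
  rw [h2, hre, mul_smul, ← h1, smul_zero]

theorem subsingleton_kaehlerDifferential (hη : IsIntegral K η)
    (hL : IntermediateField.adjoin K {η} = ⊤)
    (hno : ∀ a : K, ∃ b : K, v (η - algebraMap K L a) < v (η - algebraMap K L b))
    (hst : ∀ f : K[X], f.degree < (minpoly K η).degree →
      ∃ a : K, truncation (polyVal v η) (X - C a) f = v (aeval η f))
    (H : ∀ a : K, ∃ b : K, v (aeval η (minpoly K η).derivative) + v (η - algebraMap K L a) ≤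
      truncation (polyVal v η) (X - C b) (minpoly K η)) :
    Subsingleton (Ω[valRing v⁄valRing (restrict K v)]) := by
  have hD : ∀ y, KaehlerDifferential.D (valRing (restrict K v)) (valRing v) y = 0 := by
    intro y
    obtain ⟨a, c, z, hc0, hc, hz, P, rfl⟩ := exists_aeval_eq hη hL hno hst y
    obtain ⟨b, hb⟩ := H a
    obtain ⟨b', hab', hbb'⟩ := exists_common_bound (fun a : K => v (η - algebraMap K L a)) a b
    rw [Derivation.map_aeval, D_eq_zero_of_le hno hη z hc0 hc hz hab'
      (hb.trans (truncation_mono hno hbb' _)), smul_zero]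
  rw [← Submodule.subsingleton_iff (valRing v), ← subsingleton_iff_bot_eq_top,
    ← KaehlerDifferential.span_range_derivation, eq_comm, Submodule.span_eq_bot]
  rintro _ ⟨y, rfl⟩
  exact hD y

/-- The elements of `L` whose value is at least `v (g' η) - ν_b g` for some `b`,
where `g` is the minimal polynomial of `η`. -/
def differentSubmodule (v : AddValuation L (WithTop Γ)) (η : L)
    (hno : ∀ a : K, ∃ b : K, v (η - algebraMap K L a) < v (η - algebraMap K L b)) :
    Submodule (valRing v) L where
  carrier := {z | ∃ b : K, v (aeval η (minpoly K η).derivative) ≤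
    v z + truncation (polyVal v η) (X - C b) (minpoly K η)}
  zero_mem' := ⟨0, by simp⟩
  add_mem' := by
    rintro x y ⟨a, ha⟩ ⟨b, hb⟩
    obtain ⟨c, hac, hbc⟩ := exists_common_bound (fun a : K => v (η - algebraMap K L a)) a b
    refine ⟨c, ?_⟩
    rcases v.map_add' x y with h | h
    · exact ha.trans (add_le_add h (truncation_mono hno hac _))
    · exact hb.trans (add_le_add h (truncation_mono hno hbc _))
  smul_mem' := by
    rintro r x ⟨a, ha⟩
    refine ⟨a, ha.trans (add_le_add_left ?_ _)⟩
    have hr : 0 ≤ v (r : L) := r.2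
    rw [Subring.smul_def, smul_eq_mul, AddValuation.map_mul]
    exact le_add_of_nonneg_left hr

theorem mem_differentSubmodule
    {hno : ∀ a : K, ∃ b : K, v (η - algebraMap K L a) < v (η - algebraMap K L b)} {z : L} :
    z ∈ differentSubmodule v η hno ↔ ∃ b : K, v (aeval η (minpoly K η).derivative) ≤
      v z + truncation (polyVal v η) (X - C b) (minpoly K η) := Iff.rfl

/-- Write k - f h = g q. At a centre where f, h and k are all stable, ν_b(g q) ≥ 0, so v(q(η)) ≥
ν_b(q) ≥ -ν_b(g). The defect in the Leibniz rule is g'(η) q(η), because g(η) = 0. -/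
theorem leibniz_mem_differentSubmodule
    (hno : ∀ a : K, ∃ b : K, v (η - algebraMap K L a) < v (η - algebraMap K L b))
    (hst : ∀ f : K[X], f.degree < (minpoly K η).degree →
      ∃ a : K, truncation (polyVal v η) (X - C a) f = v (aeval η f)) {f h k : K[X]}
    (hf : f.degree < (minpoly K η).degree) (hh : h.degree < (minpoly K η).degree)
    (hk : k.degree < (minpoly K η).degree) (hf0 : 0 ≤ v (aeval η f)) (hh0 : 0 ≤ v (aeval η h))
    (hfhk : aeval η k = aeval η f * aeval η h) :
    aeval η k.derivative - (aeval η f * aeval η h.derivative + aeval η h * aeval η f.derivative) ∈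
      differentSubmodule v η hno := by
  obtain ⟨q, hq⟩ := minpoly.dvd K η (p := k - f * h) (by simp [hfhk])
  have hk0 : 0 ≤ v (aeval η k) := by
    rw [hfhk, AddValuation.map_mul]; exact add_nonneg hf0 hh0
  have hder := congrArg (fun p => aeval η (derivative p)) hq
  simp only [derivative_mul, map_sub, map_add, map_mul, minpoly.aeval, zero_mul,
    add_zero] at hder
  obtain ⟨a₁, h₁⟩ := hst f hf
  obtain ⟨a₂, h₂⟩ := hst h hh
  obtain ⟨a₃, h₃⟩ := hst k hk
  obtain ⟨a₄, h₁₄, h₂₄⟩ := exists_common_bound (fun a : K => v (η - algebraMap K L a)) a₁ a₂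
  obtain ⟨b, h₄, h₃b⟩ := exists_common_bound (fun a : K => v (η - algebraMap K L a)) a₄ a₃
  have hfb := (hf0.trans_eq h₁.symm).trans (truncation_mono hno (h₁₄.trans h₄) f)
  have hhb := (hh0.trans_eq h₂.symm).trans (truncation_mono hno (h₂₄.trans h₄) h)
  have hkb := (hk0.trans_eq h₃.symm).trans (truncation_mono hno h₃b k)
  refine ⟨b, ?_⟩
  have hqb := truncation_le_map_aeval hno b q
  obtain ⟨w, hw⟩ := exists_addValuation_eq_truncation hno b
  rw [hw] at hfb hhb hkb hqb ⊢
  have h0 : 0 ≤ w (minpoly K η * q) := by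
    rw [← hq]
    refine AddValuation.map_le_sub _ hkb ?_
    rw [AddValuation.map_mul]
    exact add_nonneg hfb hhb
  rw [AddValuation.map_mul, add_comm] at h0
  have : aeval η k.derivative - (aeval η f * aeval η h.derivative +
      aeval η h * aeval η f.derivative) = aeval η (minpoly K η).derivative * aeval η q := by
    rw [← hder]; ring
  rw [this, AddValuation.map_mul, add_assoc]
  exact le_add_of_nonneg_right (h0.trans (add_le_add_left hqb _))

/-- The polynomial of degree less than that of the minimal polynomial of `η` that takes
a given value at `η`. -/
def reduced (hη : IsIntegral K η) (hL : IntermediateField.adjoin K {η} = ⊤) (y : L) : K[X] :=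
  (exists_reduced hη hL y).choose

theorem degree_reduced_lt (hη : IsIntegral K η) (hL : IntermediateField.adjoin K {η} = ⊤)
    (y : L) : (reduced hη hL y).degree < (minpoly K η).degree :=
  (exists_reduced hη hL y).choose_spec.1

theorem aeval_reduced (hη : IsIntegral K η) (hL : IntermediateField.adjoin K {η} = ⊤)
    (y : L) : aeval η (reduced hη hL y) = y :=
  (exists_reduced hη hL y).choose_spec.2

theorem reduced_eq (hη : IsIntegral K η) (hL : IntermediateField.adjoin K {η} = ⊤) {y : L}
    {f : K[X]} (hf : f.degree < (minpoly K η).degree) (hfy : aeval η f = y) :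
    reduced hη hL y = f :=
  eq_of_aeval_eq (degree_reduced_lt hη hL y) hf ((aeval_reduced hη hL y).trans hfy.symm)

/-- The `K`-linear map `f(η) ↦ f'(η)`, `f` of degree less than that of the minimal polynomial
of `η`. -/
def reducedDerivative (hη : IsIntegral K η) (hL : IntermediateField.adjoin K {η} = ⊤) :
    L →ₗ[K] L where
  toFun y := aeval η (reduced hη hL y).derivative
  map_add' x y := by
    rw [reduced_eq hη hL (f := reduced hη hL x + reduced hη hL y), derivative_add, map_add]
    · exact lt_of_le_of_lt (degree_add_le _ _)
        (max_lt (degree_reduced_lt hη hL x) (degree_reduced_lt hη hL y))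
    · rw [map_add, aeval_reduced, aeval_reduced]
  map_smul' c x := by
    rw [reduced_eq hη hL (f := c • reduced hη hL x), derivative_smul, map_smul]
    · rfl
    · exact lt_of_le_of_lt (degree_smul_le _ _) (degree_reduced_lt hη hL x)
    · rw [map_smul, aeval_reduced]

theorem reducedDerivative_apply (hη : IsIntegral K η)
    (hL : IntermediateField.adjoin K {η} = ⊤) (y : L) :
    reducedDerivative hη hL y = aeval η (reduced hη hL y).derivative := rfl

instance isScalarTower_valRing :
    IsScalarTower (valRing (restrict K v)) (valRing v) L where
  smul_assoc r x y := by
    have h : ((r • x : valRing v) : L) = algebraMap K L r * x := rfl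
    change ((r • x : valRing v) : L) * y = (r : K) • ((x : L) * y)
    rw [h, Algebra.smul_def, mul_assoc]

/-- The derivation `f(η) ↦ f'(η)` of the valuation ring. -/
def reducedDerivation (hη : IsIntegral K η) (hL : IntermediateField.adjoin K {η} = ⊤)
    (hno : ∀ a : K, ∃ b : K, v (η - algebraMap K L a) < v (η - algebraMap K L b))
    (hst : ∀ f : K[X], f.degree < (minpoly K η).degree →
      ∃ a : K, truncation (polyVal v η) (X - C a) f = v (aeval η f)) :
    Derivation (valRing (restrict K v)) (valRing v) (L ⧸ differentSubmodule v η hno) :=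
  Derivation.mk'
    { toFun := fun y => (differentSubmodule v η hno).mkQ (reducedDerivative hη hL (y : L))
      map_add' := fun x y => by rw [Subring.coe_add, map_add, map_add]
      map_smul' := fun r y => by
        have : ((r • y : valRing v) : L) = (r : K) • (y : L) := by
          rw [Algebra.smul_def, Subring.coe_mul, coe_algebraMap_valRing, Algebra.smul_def]
        rw [this, map_smul]
        rfl }
    (fun x y => by
      change (differentSubmodule v η hno).mkQ (reducedDerivative hη hL (x * y : L)) =
        x • (differentSubmodule v η hno).mkQ (reducedDerivative hη hL (y : L)) +
        y • (differentSubmodule v η hno).mkQ (reducedDerivative hη hL (x : L))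
      rw [← map_smul (differentSubmodule v η hno).mkQ, ← map_smul (differentSubmodule v η hno).mkQ,
        ← map_add, ← sub_eq_zero, ← map_sub, Submodule.mkQ_apply, Submodule.Quotient.mk_eq_zero]
      have hx : 0 ≤ v (x : L) := x.2
      have hy : 0 ≤ v (y : L) := y.2
      have := leibniz_mem_differentSubmodule hno hst (degree_reduced_lt hη hL (x : L))
        (degree_reduced_lt hη hL (y : L)) (degree_reduced_lt hη hL (x * y : L))
        (by rwa [aeval_reduced]) (by rwa [aeval_reduced]) (by simp only [aeval_reduced])
      simpa only [aeval_reduced, Subring.smul_def, smul_eq_mul, reducedDerivative_apply] using this)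

theorem reducedDerivation_apply (hη : IsIntegral K η)
    (hL : IntermediateField.adjoin K {η} = ⊤)
    (hno : ∀ a : K, ∃ b : K, v (η - algebraMap K L a) < v (η - algebraMap K L b))
    (hst : ∀ f : K[X], f.degree < (minpoly K η).degree →
      ∃ a : K, truncation (polyVal v η) (X - C a) f = v (aeval η f)) (y : valRing v) :
    reducedDerivation hη hL hno hst y =
      (differentSubmodule v η hno).mkQ (reducedDerivative hη hL (y : L)) := rfl

/-- If the differentials vanish, so does every derivation of the valuation ring, in particular
`reducedDerivation`; its value at (η - a)/c is the class of 1/c, and membership of 1/c in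
`differentSubmodule` is the inequality. -/
theorem subsingleton_kaehlerDifferential_iff (hη : IsIntegral K η)
    (hL : IntermediateField.adjoin K {η} = ⊤)
    (hno : ∀ a : K, ∃ b : K, v (η - algebraMap K L a) < v (η - algebraMap K L b))
    (hst : ∀ f : K[X], f.degree < (minpoly K η).degree →
      ∃ a : K, truncation (polyVal v η) (X - C a) f = v (aeval η f)) :
    Subsingleton (Ω[valRing v⁄valRing (restrict K v)]) ↔
    ∀ a : K, ∃ b : K, v (aeval η (minpoly K η).derivative) + v (η - algebraMap K L a) ≤
      truncation (polyVal v η) (X - C b) (minpoly K η) := by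
  refine ⟨fun H a => ?_, subsingleton_kaehlerDifferential hη hL hno hst⟩
  obtain ⟨c, hc0, hc⟩ := exists_restrict_eq hno a
  have hcL : algebraMap K L c ≠ 0 := by simpa using hc0
  let z : valRing v := ⟨_, (map_div_eq_zero hc0 hc).ge⟩
  -- A linear polynomial is already reduced because the minimal polynomial has degree greater than
  -- 1.
  have hz : reduced hη hL (z : L) = C c⁻¹ * (X - C a) := by
    refine reduced_eq hη hL ?_ ?_
    · rw [degree_C_mul (inv_ne_zero hc0), degree_X_sub_C,
        degree_eq_natDegree (minpoly.ne_zero hη)]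
      exact_mod_cast one_lt_natDegree_minpoly hη hno
    · simp [z, div_eq_inv_mul]
  have h := (reducedDerivation hη hL hno hst).liftKaehlerDifferential_comp_D z
  rw [Subsingleton.elim (KaehlerDifferential.D _ _ z) 0, map_zero, reducedDerivation_apply,
    reducedDerivative_apply, hz, eq_comm, Submodule.mkQ_apply, Submodule.Quotient.mk_eq_zero,
    mem_differentSubmodule] at h
  obtain ⟨b, hb⟩ := h
  refine ⟨b, ?_⟩
  have h1 : aeval η (derivative (C c⁻¹ * (X - C a))) = (algebraMap K L c)⁻¹ := by simp
  rw [h1] at hb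
  refine (add_le_add_left hb _).trans_eq ?_
  rw [add_right_comm, ← hc, restrict_apply, ← AddValuation.map_mul, inv_mul_cancel₀ hcL,
    AddValuation.map_one, zero_add]

end Differentials

/-! ### The condition 1 ∈ B(F) -/

section IndexSet

variable {K L Γ : Type*} [Field K] [Field L] [Algebra K L]
  [AddCommGroup Γ] [LinearOrder Γ] [IsOrderedAddMonoid Γ]
  {v : AddValuation L (WithTop Γ)} {η : L}

theorem truncation_of_natDegree_eq_zero {ν : AddValuation K[X] (WithTop Γ)} {q f : K[X]}
    (hf : f.natDegree = 0) (hq : 1 ≤ q.natDegree) : truncation ν q f = ν f := by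
  have h : f %ₘ q = f := by
    by_cases hm : q.Monic
    · exact (modByMonic_eq_self_iff hm).2 (degree_lt_degree (by omega))
    · exact modByMonic_eq_of_not_monic f hm
  simp [truncation, hf, expCoeff, h]

/-- In x - b = (a - b) + (x - a) the coefficient of index 1 is 1. So stability of x - b at a forces
v(η - b) ≤ v(η - a), whence the degree-one key polynomials are cofinal. -/
theorem truncation_X_sub_C_X_sub_C_le (a b : K) :
    truncation (polyVal v η) (X - C a) (X - C b) ≤ v (η - algebraMap K L a) := by
  have h : polyVal v η (expCoeff (X - C a) (X - C b) 1 * (X - C a) ^ 1) =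
      v (η - algebraMap K L a) := by
    rw [polyVal_expCoeff, taylor_coeff_one]
    simp
  rw [← h, truncation]
  exact Finset.inf_le (by simp)

/-- The criterion for `1 ∈ B(F)` in terms of the minimal polynomial of `η`, for `F` a limit key
polynomial of the same degree. -/
theorem one_mem_indexSet_iff (hη : IsIntegral K η)
    (hno : ∀ a : K, ∃ b : K, v (η - algebraMap K L a) < v (η - algebraMap K L b))
    {S : Set K[X]} (hS : ∀ q ∈ S, ∃ a, q = X - C a)
    (hcof : ∀ b : K, ∃ a : K, X - C a ∈ S ∧ v (η - algebraMap K L b) ≤ v (η - algebraMap K L a))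
    (hst : ∀ f : K[X], f.degree < (minpoly K η).degree →
      ∃ a : K, truncation (polyVal v η) (X - C a) f = v (aeval η f))
    {F : K[X]} (hF : F.Monic) (hFdeg : F.natDegree = (minpoly K η).natDegree)
    (hFS : ¬ IsStable (polyVal v η) S F) :
    1 ∈ indexSet (polyVal v η) S 1 F ↔
    ∀ a : K, ∃ b : K, v (aeval η (minpoly K η).derivative) + v (η - algebraMap K L a) ≤
      truncation (polyVal v η) (X - C b) (minpoly K η) := by
  have hg0 : minpoly K η ≠ 0 := minpoly.ne_zero hη
  have hn := one_lt_natDegree_minpoly hη hno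
  have hdir := exists_common_bound (fun a : K => v (η - algebraMap K L a))
  set g := minpoly K η with hg
  obtain ⟨h, rfl⟩ : ∃ h, F = g + h := ⟨F - g, by ring⟩
  have hhdeg : h.degree < g.degree := by
    have := degree_sub_lt_right (p := g + h) (q := g)
      (by rw [degree_eq_natDegree hF.ne_zero, degree_eq_natDegree hg0, hFdeg]) hg0
      (by rw [hF.leadingCoeff, (minpoly.monic hη).leadingCoeff])
    rwa [add_sub_cancel_left] at this
  have hhη : aeval η h = aeval η (g + h) := by rw [map_add, hg, minpoly.aeval, zero_add]
  obtain ⟨a₁, h₁⟩ := hst h hhdeg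
  have hstab : ∀ a, v (η - algebraMap K L a₁) ≤ v (η - algebraMap K L a) →
      truncation (polyVal v η) (X - C a) h = v (aeval η h) := fun a ha =>
    le_antisymm (truncation_le_map_aeval hno a h) (h₁.symm.trans_le (truncation_mono hno ha h))
  have hlt : ∀ a, X - C a ∈ S →
      truncation (polyVal v η) (X - C a) (g + h) < v (aeval η h) := fun a ha =>
    lt_of_le_of_ne (hhη ▸ truncation_le_map_aeval hno a (g + h))
      fun H => hFS ⟨_, ha, by rw [H, hhη, polyVal_apply]⟩
  -- Beyond `a₁` the truncation of h equals v(h(η)) = ν(F), which exceeds that of F by instability;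
  -- removing h from F therefore changes nothing.
  have htr : ∀ a, X - C a ∈ S → v (η - algebraMap K L a₁) ≤ v (η - algebraMap K L a) →
      truncation (polyVal v η) (X - C a) (g + h) = truncation (polyVal v η) (X - C a) g := by
    intro a ha ha₁
    have hl := hlt a ha
    rw [← hstab a ha₁] at hl
    obtain ⟨w, hw⟩ := exists_addValuation_eq_truncation hno a
    rw [hw, hw] at hl ⊢
    rw [← AddValuation.map_sub_eq_of_lt_left w hl, add_sub_cancel_right]
  -- The share of h in the term of index 1 lies above every truncation of F, so it cannot affect
  -- membership in the lower cut.
  have hh' : ∀ a b, v (η - algebraMap K L a₁) ≤ v (η - algebraMap K L a) → X - C b ∈ S →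
      truncation (polyVal v η) (X - C b) (g + h) <
        v (algebraMap K L (h.derivative.eval a) * (η - algebraMap K L a)) := by
    intro a b ha hb
    refine (hlt b hb).trans_le ?_
    rw [← hstab a ha, AddValuation.map_mul]
    exact truncation_le_map_eval_derivative hno a h
  have hFt : ∀ a : K, polyVal v η (expCoeff (X - C a) (g + h) 1 * (X - C a) ^ 1) =
      v (algebraMap K L (g.derivative.eval a) * (η - algebraMap K L a) +
        algebraMap K L (h.derivative.eval a) * (η - algebraMap K L a)) := by
    intro a
    rw [polyVal_expCoeff, taylor_coeff_one, one_nsmul, restrict_apply, ← AddValuation.map_mul,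
      derivative_add, eval_add, map_add, add_mul]
  have hcof' : ∀ a b : K, ∃ c : K, X - C c ∈ S ∧
      v (η - algebraMap K L a) ≤ v (η - algebraMap K L c) ∧
      v (η - algebraMap K L b) ≤ v (η - algebraMap K L c) := by
    intro a b
    obtain ⟨c, hac, hbc⟩ := hdir a b
    obtain ⟨d, hd, hcd⟩ := hcof c
    exact ⟨d, hd, hac.trans hcd, hbc.trans hcd⟩
  -- The derivative of g has smaller degree, so it is stable and its values at good centres are
  -- eventually constant.
  obtain ⟨a₂, h₂⟩ : ∃ a₂ : K, ∀ a, v (η - algebraMap K L a₂) ≤ v (η - algebraMap K L a) →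
      v (algebraMap K L (g.derivative.eval a)) = v (aeval η g.derivative) := by
    obtain ⟨b, hb⟩ := hst g.derivative (degree_derivative_lt hg0)
    obtain ⟨c, hc⟩ := hno b
    exact ⟨c, fun a ha => map_eval_eq_of_truncation_eq hno hb (hc.trans_le ha)⟩
  constructor
  · rintro ⟨-, -, q₀, hq₀, H⟩ a
    obtain ⟨a₀, rfl⟩ := hS q₀ hq₀
    obtain ⟨a₃, h₁₃, h₂₃⟩ := hdir a₁ a₂
    obtain ⟨a₄, h₀₄, haa₄⟩ := hdir a₀ a
    obtain ⟨c, hcS, h₃c, h₄c⟩ := hcof' a₃ a₄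
    obtain ⟨γ, ⟨δ, ⟨q, hqS, hδ⟩, hγδ⟩, hγ⟩ := H (X - C c) hcS (by
      rw [polyVal_X_sub_C, polyVal_X_sub_C]; exact h₀₄.trans h₄c)
    obtain ⟨b, rfl⟩ := hS q hqS
    -- The centre b may come before `a₁`; d is beyond both, so that F may be replaced by g in the
    -- truncation.
    obtain ⟨d, hdS, hbd, h₁d⟩ := hcof' b a₁
    refine ⟨d, ?_⟩
    have hle : (γ : WithTop Γ) ≤ truncation (polyVal v η) (X - C b) (g + h) := by
      rw [hδ]; exact_mod_cast hγδ
    have h3 := hle.trans_lt (hh' c b (h₁₃.trans h₃c) hqS)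
    rw [hFt] at hγ
    have h4 : v (algebraMap K L (g.derivative.eval c) * (η - algebraMap K L c)) = γ := by
      rw [← hγ] at h3 ⊢
      rw [← AddValuation.map_sub_eq_of_lt_left v h3, add_sub_cancel_right]
    rw [AddValuation.map_mul, h₂ c (h₂₃.trans h₃c)] at h4
    calc _ ≤ v (aeval η g.derivative) + v (η - algebraMap K L c) :=
          add_le_add_right (haa₄.trans h₄c) _
      _ = γ := h4
      _ ≤ _ := hle
      _ ≤ _ := truncation_mono hno hbd _
      _ = _ := htr d hdS h₁d
  · intro H
    obtain ⟨a₀, h₀S, h₁₀, h₂₀⟩ := hcof' a₁ a₂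
    refine ⟨le_rfl, by rw [hFdeg, Nat.div_one]; exact hn, _, h₀S, fun q hq hq₀ => ?_⟩
    obtain ⟨a, rfl⟩ := hS q hq
    rw [polyVal_X_sub_C, polyVal_X_sub_C] at hq₀
    obtain ⟨b, hb⟩ := H a
    obtain ⟨d, hdS, hbd, h₁d⟩ := hcof' b a₁
    have h3 : v (algebraMap K L (g.derivative.eval a) * (η - algebraMap K L a)) ≤
        truncation (polyVal v η) (X - C d) (g + h) := by
      rw [AddValuation.map_mul, h₂ a (h₂₀.trans hq₀), htr d hdS h₁d]
      exact hb.trans (truncation_mono hno hbd _)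
    have h4 := h3.trans_lt (hh' a d (h₁₀.trans hq₀) hdS)
    rw [hFt, AddValuation.map_add_eq_of_lt_left v h4]
    obtain ⟨δ, hδ⟩ := WithTop.ne_top_iff_exists.1 (ne_top_of_lt (hlt d hdS))
    obtain ⟨γ, hγ⟩ := WithTop.ne_top_iff_exists.1 (ne_top_of_lt h4)
    refine ⟨γ, ⟨δ, ⟨_, hdS, hδ.symm⟩, ?_⟩, hγ.symm⟩
    rw [← hγ, ← hδ] at h3
    exact_mod_cast h3

end IndexSet

end

end KeyPol

/-! ### The proposition -/

theorem proposition1p7 {K L Kbar Γ I : Type*} [Field K] [Field L] [Algebra K L]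
    [Field Kbar] [Algebra K Kbar] [IsAlgClosure K Kbar]
    [AddCommGroup Γ] [LinearOrder Γ] [IsOrderedAddMonoid Γ]
    (v : AddValuation L (WithTop Γ)) (η : L) (hη : IsIntegral K η)
    (hL : IntermediateField.adjoin K {η} = ⊤)
    (νbar : AddValuation (Polynomial Kbar) (WithTop Γ))
    (hνbar : ∀ f : Polynomial K, νbar (f.map (algebraMap K Kbar)) = KeyPol.polyVal v η f)
    (hmax : ¬ ∃ a : K, ∀ b : K,
      KeyPol.polyVal v η (Polynomial.X - Polynomial.C b : Polynomial K) ≤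
        KeyPol.polyVal v η (Polynomial.X - Polynomial.C a : Polynomial K))
    (hkey : ∀ n : ℕ, 1 < n → n < (minpoly K η).natDegree →
      ¬ ∃ q : Polynomial K, KeyPol.IsKeyPolynomial νbar q ∧ q.natDegree = n)
    [LinearOrder I] (Q : I → Polynomial K)
    (hQ : KeyPol.IsKeyPolynomialSequence (KeyPol.polyVal v η) νbar Q) :
    KeyPol.IsPlateau (KeyPol.polyVal v η) (KeyPol.ofDegree (Set.range Q) 1) ∧
    (∃ F : Polynomial K, KeyPol.IsLimitKeyPolynomial (KeyPol.polyVal v η)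
      (KeyPol.ofDegree (Set.range Q) 1) F) ∧
    ∀ F : Polynomial K, KeyPol.IsLimitKeyPolynomial (KeyPol.polyVal v η)
        (KeyPol.ofDegree (Set.range Q) 1) F →
      (Subsingleton (Ω[KeyPol.valRing v⁄KeyPol.valRing (KeyPol.restrict K v)]) ↔
        1 ∈ KeyPol.indexSet (KeyPol.polyVal v η) (KeyPol.ofDegree (Set.range Q) 1) 1 F) := by
  have hno : ∀ a : K, ∃ b : K, v (η - algebraMap K L a) < v (η - algebraMap K L b) := by
    push Not at hmax
    intro a
    obtain ⟨b, hb⟩ := hmax a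
    exact ⟨b, by simpa only [KeyPol.polyVal_X_sub_C] using hb⟩
  set S := KeyPol.ofDegree (Set.range Q) 1 with hSdef
  have hS : ∀ q ∈ S, ∃ a, q = X - C a := by
    rintro q ⟨⟨i, rfl⟩, hq⟩
    refine ⟨-(Q i).coeff 0, ?_⟩
    rw [C_neg, sub_neg_eq_add]
    exact (hQ.isKeyPolynomial i).1.eq_X_add_C hq
  have hcompl : ∀ f : K[X], f.natDegree < (minpoly K η).natDegree → 1 ≤ f.natDegree →
      ∃ q ∈ S, KeyPol.truncation (KeyPol.polyVal v η) q f = KeyPol.polyVal v η f := by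
    intro f hf hf1
    obtain ⟨q, ⟨i, rfl⟩, hq, H⟩ := hQ.isComplete.2 f hf1
    refine ⟨Q i, ⟨⟨i, rfl⟩, ?_⟩, H.symm⟩
    -- The key polynomial from completeness has degree at most deg f < deg g; a degree other than 1
    -- would be one of the excluded ones.
    by_contra h1
    have h2 := (hQ.isKeyPolynomial i).2.1
    exact hkey _ (by omega) (by omega) ⟨Q i, hQ.isKeyPolynomial i, rfl⟩
  have hn := KeyPol.one_lt_natDegree_minpoly hη hno
  have hcof : ∀ b : K, ∃ a : K,
      X - C a ∈ S ∧ v (η - algebraMap K L b) ≤ v (η - algebraMap K L a) := by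
    intro b
    obtain ⟨q, hq, H⟩ := hcompl (X - C b) (by simpa using hn) (by simp)
    obtain ⟨a, rfl⟩ := hS q hq
    refine ⟨a, hq, ?_⟩
    rw [KeyPol.polyVal_X_sub_C] at H
    rw [← H]
    exact KeyPol.truncation_X_sub_C_X_sub_C_le a b
  have hstable : ∀ f : K[X], f.natDegree < (minpoly K η).natDegree →
      KeyPol.IsStable (KeyPol.polyVal v η) S f := by
    intro f hf
    by_cases hf1 : 1 ≤ f.natDegree
    · exact hcompl f hf hf1
    · obtain ⟨a, ha, -⟩ := hcof 0
      exact ⟨_, ha, KeyPol.truncation_of_natDegree_eq_zero (by omega) (by simp)⟩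
  have hst : ∀ f : K[X], f.degree < (minpoly K η).degree →
      ∃ a : K, KeyPol.truncation (KeyPol.polyVal v η) (X - C a) f = v (aeval η f) := by
    intro f hf
    obtain ⟨q, hq, H⟩ := hstable f (by
      rcases eq_or_ne f 0 with rfl | hf0
      · simpa using hn.pos
      · exact natDegree_lt_natDegree hf0 hf)
    obtain ⟨a, rfl⟩ := hS q hq
    exact ⟨a, H⟩
  -- The minimal polynomial has value ⊤, whereas its linear truncations are finite.
  have hg : ¬ KeyPol.IsStable (KeyPol.polyVal v η) S (minpoly K η) := by
    rintro ⟨q, hq, H⟩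
    obtain ⟨a, rfl⟩ := hS q hq
    refine KeyPol.truncation_ne_top hno a (minpoly.ne_zero hη) ?_
    rw [H, KeyPol.polyVal_apply, minpoly.aeval, AddValuation.map_zero]
  have hmin : ∀ f : K[X], ¬ KeyPol.IsStable (KeyPol.polyVal v η) S f →
      (minpoly K η).natDegree ≤ f.natDegree := fun f hf =>
    not_lt.1 fun h => hf (hstable f h)
  refine ⟨⟨?_, ?_⟩, ⟨minpoly K η, minpoly.monic hη, hg, hmin⟩, ?_⟩
  · obtain ⟨a, ha, -⟩ := hcof 0
    exact ⟨_, ha⟩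
  · rintro ⟨q, hq, H⟩
    obtain ⟨a, rfl⟩ := hS q hq
    obtain ⟨b, hb⟩ := hno a
    obtain ⟨c, hc, hbc⟩ := hcof b
    have := H _ hc
    rw [KeyPol.polyVal_X_sub_C, KeyPol.polyVal_X_sub_C] at this
    exact absurd (hb.trans_le hbc) this.not_gt
  · rintro F ⟨hF, hFS, hFmin⟩
    rw [KeyPol.subsingleton_kaehlerDifferential_iff hη hL hno hst,
      KeyPol.one_mem_indexSet_iff hη hno hS hcof hst hF
        (le_antisymm (hFmin _ hg) (hmin F hFS)) hFS]
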